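/- Let $n\ge 0$ be an integer, let $\eta$ be the exponential measure $e^{-x}\mathbf 1_{x\ge 0}\,dx$ on $\mathbb R$ and let $\eta^n$ be its $n$-fold product on $\mathbb R^n$. Put $\Lambda^*_\eta(t)=t-1-\log t$ for $t>0$ and $\Lambda^*_\eta(t)=+\infty$ for $t\le 0$, and $$c(x,y)=\sum_{i=1}^n y_i\,\Lambda^*_\eta\Big(\frac{x_i}{y_i}\Big)\in[0,+\infty],\qquad x,y\in\mathbb R^n,$$ where for $y_i\le 0$ the $i$-th term is understood as $x_i$ if $y_i=0\le x_i$ and as $+\infty$ otherwise (its lower semicontinuous extension; the points with some $y_i\le 0$ form an $\eta^n$-null set). For probability measures $\nu,\mu$ on $\mathbb R^n$ let $$\mathcal W_c(\nu,\mu)=\inf_\pi\int c(x,y)\,d\pi(x,y),$$ the infimum running over all couplings $\pi$ of $\nu$ and $\mu$ (first marginal $\nu$, second marginal $\mu$), and let $H(\nu|\mu)\in[0,+\infty]$ be the relative entropy, i.e. $\int\log\frac{d\nu}{d\mu}\,d\nu$ if $\nu\ll\mu$ and $+\infty$ otherwise. A probability measure $\nu$ is called a tilt of $\mu$ if $\nu\ll\mu$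 and $\log\frac{d\nu}{d\mu}$ is ($\mu$-almost everywhere) an affine function. Then: 1. for every probability measure $\nu$ on $\mathbb R^n$, $$\mathcal W_c(\nu,\eta^n)\le H(\nu|\eta^n);$$ 2. if $\nu$ is a tilt of $\eta^n$, then $\mathcal W_c(\nu,\eta^n)=H(\nu|\eta^n)$; 3. the tilts of $\eta^n$ are exactly the products of rescaled exponential measures, i.e. the measures $\eta_{\lambda_1}\otimes\cdots\otimes\eta_{\lambda_n}$ with $\lambda_1,\dots,\lambda_n>0$, where $\eta_\lambda$ is the image of $\eta$ under $x\mapsto\lambda x$. -/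

import Mathlib

open MeasureTheory ProbabilityTheory InformationTheory
open scoped ENNReal

noncomputable section

namespace TranspExp

/-- `π` is a coupling between `ν` and `μ`: its first marginal is `ν`, its second one is `μ`. -/
def IsCoupling {E : Type*} [MeasurableSpace E] (π : Measure (E × E)) (ν μ : Measure E) : Prop :=
  π.map Prod.fst = ν ∧ π.map Prod.snd = μ

/-- The transportation cost `W_c(ν, μ) = inf_π ∫ c(x, y) dπ(x, y)`, the infimum running over all
couplings `π` between `ν` and `μ`. -/
def transportCost {E : Type*} [MeasurableSpace E] (c : E → E → ℝ≥0∞) (ν μ : Measure E) : ℝ≥0∞ :=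
  ⨅ (π : Measure (E × E)) (_ : IsCoupling π ν μ), ∫⁻ z, c z.1 z.2 ∂π

/-- `Λ*_η(t) = t - 1 - log t` for `t > 0`, and `+∞` for `t ≤ 0`. The real number
`t - 1 - log t` is nonnegative, so that `ENNReal.ofReal` truncates nothing. -/
def expRate (t : ℝ) : ℝ≥0∞ :=
  if 0 < t then ENNReal.ofReal (t - 1 - Real.log t) else ∞

/-- The one-dimensional cost `y Λ*_η(x / y)` for `y > 0`. For `y ≤ 0`, a null set for the
exponential measure, it is extended lower semicontinuously: its value is `x` if `y = 0 ≤ x`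
(the limit as `y` decreases to `0`), and `+∞` otherwise. -/
def expCost₁ (x y : ℝ) : ℝ≥0∞ :=
  if 0 < y then ENNReal.ofReal y * expRate (x / y)
  else if y = 0 ∧ 0 ≤ x then ENNReal.ofReal x
  else ∞

/-- The cost `c(x, y) = ∑ i, y_i Λ*_η(x_i / y_i)` on `ℝⁿ × ℝⁿ`. -/
def expCost {n : ℕ} (x y : Fin n → ℝ) : ℝ≥0∞ :=
  ∑ i, expCost₁ (x i) (y i)

/-- The exponential measure `η = e^{-x} 1_{x ≥ 0} dx` on `ℝ`. -/
abbrev eta : Measure ℝ := expMeasure 1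

/-- The `n`-fold product `η^n`. -/
def etaPow (n : ℕ) : Measure (Fin n → ℝ) := Measure.pi fun _ => eta

/-- `ν` is a tilt of `μ`: it is a probability measure with a density with respect to `μ`, and
the logarithm of this density is an affine function. -/
def IsTilt {n : ℕ} (ν μ : Measure (Fin n → ℝ)) : Prop :=
  IsProbabilityMeasure ν ∧
    ∃ l : (Fin n → ℝ) →ᵃ[ℝ] ℝ, ν = μ.withDensity fun x => ENNReal.ofReal (Real.exp (l x))

end TranspExp

end

noncomputable section

namespace TranspExp

open Set Filter

/-! In dimension one, let `G` be the survival function of `ν ≪ eta`. The map `S = -log G` sends `ν`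
to `eta` and is the integral of the hazard rate `h = p / G`, where `p` is the Lebesgue density. For
positive arguments the cost is `x * klFun (S / x)`, so Jensen on `[0, x]` bounds it by the integral
of `klFun ∘ h` there. Integrating in `x` against `ν` gives `∫ klFun h * G`, and this is exactly the
relative entropy: the correction terms in `klFun_identity` integrate to the mean of `ν` plus `1` on
both sides.

In dimension `n`, disintegrate with respect to one coordinate, move the conditional laws by their
own cumulative hazards, and add the costs by the chain rule for entropy
(`HasEntropicTransport.prod_eta`).

For tilts, the lower bound is Kantorovich duality: the cost dominates `∑ i, ((1 - b i) * x i + y i *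
log (b i))`, whose integral depends only on the marginals and equals the entropy. Normalisation
forces every slope of a tilt below `1`, leaving only products of exponential laws. -/

/-- Lebesgue measure on the half-line `[0, ∞)`. -/
abbrev halfLine : Measure ℝ := volume.restrict (Ici 0)

/-! ### Exponential measures: densities, tails, scaling, mean. -/

instance isProbabilityMeasure_eta : IsProbabilityMeasure eta :=
  isProbabilityMeasure_expMeasure one_pos

lemma expMeasure_eq_withDensity (b : ℝ) :
    expMeasure b = halfLine.withDensity fun x => ENNReal.ofReal (b * Real.exp (-(b * x))) := by
  rw [← withDensity_indicator measurableSet_Ici]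
  change volume.withDensity (exponentialPDF b) = _
  congr 1
  ext x
  rw [exponentialPDF_eq]
  by_cases hx : 0 ≤ x <;> simp [hx]

lemma eta_eq_withDensity :
    eta = halfLine.withDensity fun x => ENNReal.ofReal (Real.exp (-x)) := by
  rw [eta, expMeasure_eq_withDensity]
  simp

lemma expMeasure_eq_eta_withDensity {b : ℝ} (hb : 0 < b) :
    expMeasure b =
      eta.withDensity fun x => ENNReal.ofReal (Real.exp ((1 - b) * x + Real.log b)) := by
  rw [eta_eq_withDensity, expMeasure_eq_withDensity, ← withDensity_mul _ (by fun_prop) (by fun_prop)]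
  congr 1
  ext x
  rw [Pi.mul_apply, ← ENNReal.ofReal_mul (by positivity), ← Real.exp_add, mul_comm]
  congr 1
  nth_rw 2 [← Real.exp_log hb]
  rw [← Real.exp_add]
  congr 1
  ring

lemma expMeasure_absolutelyContinuous (b : ℝ) : expMeasure b ≪ volume :=
  withDensity_absolutelyContinuous _ _

instance expMeasure_nullSingletonClass (b : ℝ) : NullSingletonClass (expMeasure b) :=
  ⟨fun x => expMeasure_absolutelyContinuous b (by simp)⟩

lemma expMeasure_Ici {b : ℝ} (hb : 0 < b) (t : ℝ) :
    expMeasure b (Ici t) = if 0 ≤ t then ENNReal.ofReal (Real.exp (-(b * t))) else 1 := by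
  have := isProbabilityMeasure_expMeasure hb
  have h := cdf_expMeasure_eq hb t
  rw [cdf_eq_real] at h
  rw [measure_congr Ioi_ae_eq_Ici.symm, ← compl_Iic, ← ofReal_measureReal,
    probReal_compl_eq_one_sub measurableSet_Iic, h]
  split_ifs <;> simp

lemma eta_Ici {t : ℝ} (ht : 0 ≤ t) : eta (Ici t) = ENNReal.ofReal (Real.exp (-t)) := by
  rw [expMeasure_Ici one_pos, if_pos ht, one_mul]

lemma eta_Ici_of_nonpos {t : ℝ} (ht : t ≤ 0) : eta (Ici t) = 1 := by
  rcases ht.lt_or_eq with h | rfl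
  · rw [expMeasure_Ici one_pos, if_neg (not_le.2 h)]
  · simp [eta_Ici]

lemma ae_eta_pos : ∀ᵐ x ∂eta, 0 < x := by
  have h : eta (Ioi 0) = 1 := by
    rw [measure_congr Ioi_ae_eq_Ici, eta_Ici_of_nonpos le_rfl]
  exact (mem_ae_iff_prob_eq_one measurableSet_Ioi).2 h

lemma map_mul_left_eta {r : ℝ} (hr : 0 < r) :
    eta.map (fun x => r * x) = expMeasure r⁻¹ := by
  have := isProbabilityMeasure_expMeasure (inv_pos.2 hr)
  have : IsProbabilityMeasure (eta.map fun x => r * x) :=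
    Measure.isProbabilityMeasure_map (by fun_prop)
  refine Measure.ext_of_Ici _ _ fun t => ?_
  have : (fun x => r * x) ⁻¹' Ici t = Ici (t / r) := by
    ext x
    simp [div_le_iff₀' hr]
  rw [Measure.map_apply (by fun_prop) measurableSet_Ici, this, expMeasure_Ici one_pos,
    expMeasure_Ici (inv_pos.2 hr)]
  simp only [div_nonneg_iff, hr.le, hr.not_ge, and_true, and_false, or_false, one_mul]
  rw [div_eq_inv_mul]

lemma lintegral_exp_neg_halfLine : ∫⁻ s, ENNReal.ofReal (Real.exp (-s)) ∂halfLine = 1 := by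
  have h := measure_univ (μ := eta)
  rwa [eta_eq_withDensity, withDensity_apply _ MeasurableSet.univ, setLIntegral_univ] at h

lemma lintegral_eta_ofReal : ∫⁻ y, ENNReal.ofReal y ∂eta = 1 := by
  rw [lintegral_eq_lintegral_meas_le eta (ae_eta_pos.mono fun _ h => h.le) aemeasurable_id,
    ← lintegral_exp_neg_halfLine, restrict_Ioi_eq_restrict_Ici]
  refine setLIntegral_congr_fun measurableSet_Ici fun t ht => ?_
  exact eta_Ici ht

lemma integrable_id_eta : Integrable (fun y : ℝ => y) eta := by
  rw [← lintegral_ofReal_ne_top_iff_integrable (by fun_prop) (ae_eta_pos.mono fun _ h => h.le),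
    lintegral_eta_ofReal]
  exact ENNReal.one_ne_top

lemma integral_id_eta : ∫ y, y ∂eta = 1 := by
  rw [integral_eq_lintegral_of_nonneg_ae (ae_eta_pos.mono fun _ h => h.le) (by fun_prop),
    lintegral_eta_ofReal, ENNReal.toReal_one]

lemma integrable_id_expMeasure {b : ℝ} (hb : 0 < b) :
    Integrable (fun y : ℝ => y) (expMeasure b) := by
  rw [← inv_inv b, ← map_mul_left_eta (inv_pos.2 hb),
    integrable_map_measure (by fun_prop) (by fun_prop)]
  exact integrable_id_eta.const_mul _

/-- Excludes slopes at least `1` in the log-density of a tilt. -/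
lemma lintegral_exp_mul_eta_eq_top {a : ℝ} (ha : 1 ≤ a) :
    ∫⁻ x, ENNReal.ofReal (Real.exp (a * x)) ∂eta = ∞ := by
  rw [eta_eq_withDensity, lintegral_withDensity_eq_lintegral_mul _ (by fun_prop) (by fun_prop),
    eq_top_iff]
  calc ∞ = ∫⁻ _, 1 ∂halfLine := by simp
    _ ≤ _ := by
      refine setLIntegral_mono (by fun_prop) fun x (hx : 0 ≤ x) => ?_
      rw [Pi.mul_apply, ← ENNReal.ofReal_mul (by positivity), ← Real.exp_add,
        ENNReal.one_le_ofReal, Real.one_le_exp_iff]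
      nlinarith

/-! ### The cumulative hazard as a transport map. -/

/-- The survival function `x ↦ ν (x, ∞)`. -/
def survival (ν : Measure ℝ) (x : ℝ) : ℝ := ν.real (Ioi x)

/-- The cumulative hazard `x ↦ -log ν (x, ∞)`. -/
def cumHazard (ν : Measure ℝ) (x : ℝ) : ℝ := -Real.log (survival ν x)

section Survival

variable {ν : Measure ℝ}

lemma survival_nonneg (x : ℝ) : 0 ≤ survival ν x := measureReal_nonneg

lemma exp_neg_cumHazard {x : ℝ} (hx : 0 < survival ν x) :
    Real.exp (-cumHazard ν x) = survival ν x := by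
  rw [cumHazard, neg_neg, Real.exp_log hx]

variable [IsProbabilityMeasure ν]

lemma survival_le_one (x : ℝ) : survival ν x ≤ 1 := measureReal_le_one

lemma survival_eq (x : ℝ) : survival ν x = 1 - cdf ν x := by
  rw [survival, cdf_eq_real, ← compl_Iic, probReal_compl_eq_one_sub measurableSet_Iic]

lemma ofReal_survival (x : ℝ) : ENNReal.ofReal (survival ν x) = ν (Ioi x) := by
  simp [survival]

lemma survival_antitone : Antitone (survival ν) := fun x y h => by
  simp only [survival_eq]
  linarith [monotone_cdf ν h]

lemma measurable_survival : Measurable (survival ν) := survival_antitone.measurable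

lemma measurable_cumHazard : Measurable (cumHazard ν) := measurable_survival.log.neg

lemma cumHazard_nonneg (x : ℝ) : 0 ≤ cumHazard ν x :=
  neg_nonneg.2 (Real.log_nonpos (survival_nonneg x) (survival_le_one x))

lemma cumHazard_le_of_le {x y : ℝ} (hxy : x ≤ y) (hy : 0 < survival ν y) :
    cumHazard ν x ≤ cumHazard ν y :=
  neg_le_neg (Real.log_le_log hy (survival_antitone hxy))

variable [NullSingletonClass ν]

lemma ofReal_survival_eq_Ici (x : ℝ) : ENNReal.ofReal (survival ν x) = ν (Ici x) := by
  rw [ofReal_survival, measure_congr Ioi_ae_eq_Ici]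

lemma continuous_survival : Continuous (survival ν) := by
  have : Continuous (cdf ν) := by
    refine continuous_iff_continuousAt.2 fun x => ?_
    rw [(monotone_cdf ν).continuousAt_iff_leftLim_eq_rightLim, (cdf ν).rightLim_eq]
    have h := (cdf ν).measure_singleton x
    rw [measure_cdf, measure_singleton, eq_comm, ENNReal.ofReal_eq_zero] at h
    exact le_antisymm ((monotone_cdf ν).leftLim_le le_rfl) (by linarith)
  rw [funext survival_eq]
  exact continuous_const.sub this

/-- The survival function of an atomless law is uniformly distributed: by continuity the sublevel
set is a closed half-line whose endpoint has survival exactly `u`. -/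
lemma measure_survival_le {u : ℝ} (hu : 0 < u) (hu1 : u ≤ 1) :
    ν {x | survival ν x ≤ u} = ENNReal.ofReal u := by
  rcases hu1.lt_or_eq with hu1 | rfl
  swap
  · simp [survival_le_one]
  have htop : Tendsto (survival ν) atTop (nhds 0) := by
    simpa [← funext survival_eq] using (tendsto_cdf_atTop ν).const_sub 1
  have hbot : Tendsto (survival ν) atBot (nhds 1) := by
    simpa [← funext survival_eq] using (tendsto_cdf_atBot ν).const_sub 1
  obtain ⟨a, ha⟩ := (hbot.eventually (lt_mem_nhds hu1)).exists
  obtain ⟨b, hb⟩ := (htop.eventually (gt_mem_nhds hu)).exists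
  obtain ⟨z, hz⟩ : u ∈ range (survival ν) :=
    mem_range_of_exists_le_of_exists_ge continuous_survival ⟨b, hb.le⟩ ⟨a, ha.le⟩
  set A := {x | survival ν x ≤ u} with hA
  have hne : A.Nonempty := ⟨z, hz.le⟩
  have hbdd : BddBelow A := ⟨a, fun x hx => by
    by_contra! h
    exact absurd (survival_antitone h.le) (not_le.2 (lt_of_le_of_lt hx ha))⟩
  have hmem : sInf A ∈ A :=
    (isClosed_le continuous_survival continuous_const).csInf_mem hne hbdd
  have hIci : A = Ici (sInf A) := by
    ext x
    exact ⟨fun hx => csInf_le hbdd hx, fun hx => (survival_antitone hx).trans hmem⟩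
  rw [hIci, ← ofReal_survival_eq_Ici]
  congr 1
  refine le_antisymm hmem ?_
  rw [← hz]
  exact survival_antitone (csInf_le hbdd hz.le)

/-- The zero set lies in sublevel sets of arbitrarily small measure. Hence the default value `log 0
= 0` is harmless in `cumHazard`. -/
lemma ae_survival_pos : ∀ᵐ x ∂ν, 0 < survival ν x := by
  rw [ae_iff, ← nonpos_iff_eq_zero]
  refine ENNReal.le_of_forall_pos_le_add fun ε hε _ => ?_
  rw [zero_add]
  have h : 0 < min (ε : ℝ) 1 := lt_min hε one_pos
  calc ν {x | ¬0 < survival ν x} ≤ ν {x | survival ν x ≤ min (ε : ℝ) 1} :=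
        measure_mono fun x hx => (not_lt.1 hx).trans h.le
    _ = ENNReal.ofReal (min (ε : ℝ) 1) := measure_survival_le h (min_le_right _ _)
    _ ≤ ENNReal.ofReal ε := ENNReal.ofReal_le_ofReal (min_le_left _ _)
    _ = ε := ENNReal.ofReal_coe_nnreal

/-- The cumulative hazard transports an atomless measure to the exponential measure. -/
lemma map_cumHazard : ν.map (cumHazard ν) = eta := by
  have : IsProbabilityMeasure (ν.map (cumHazard ν)) :=
    Measure.isProbabilityMeasure_map measurable_cumHazard.aemeasurable
  refine Measure.ext_of_Ici _ _ fun t => ?_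
  rw [Measure.map_apply measurable_cumHazard measurableSet_Ici]
  rcases le_total t 0 with ht | ht
  · rw [eta_Ici_of_nonpos ht, ← measure_univ (μ := ν)]
    congr 1
    exact eq_univ_of_forall fun x => ht.trans (cumHazard_nonneg x)
  · rw [eta_Ici ht, ← measure_survival_le (ν := ν) (Real.exp_pos _) (by simpa using ht)]
    refine measure_congr ?_
    filter_upwards [ae_survival_pos (ν := ν)] with x hx
    change (t ≤ cumHazard ν x) = (survival ν x ≤ Real.exp (-t))
    rw [← exp_neg_cumHazard hx, Real.exp_le_exp, neg_le_neg_iff]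

lemma lintegral_cumHazard : ∫⁻ x, ENNReal.ofReal (cumHazard ν x) ∂ν = 1 := by
  rw [← lintegral_eta_ofReal, ← map_cumHazard (ν := ν),
    lintegral_map (by fun_prop) measurable_cumHazard]

lemma ae_cumHazard_pos : ∀ᵐ x ∂ν, 0 < cumHazard ν x := by
  refine ae_of_ae_map measurable_cumHazard.aemeasurable (p := fun y => 0 < y) ?_
  rw [map_cumHazard]
  exact ae_eta_pos

/-- The hazard may be constant on intervals, but these carry no mass: one set contains the other,
and both complements have measure `survival ν x`. -/
lemma Iic_ae_eq_cumHazard_le {x : ℝ} (hx : 0 < survival ν x) :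
    Iic x =ᵐ[ν] cumHazard ν ⁻¹' Iic (cumHazard ν x) := by
  have hmeas : MeasurableSet (cumHazard ν ⁻¹' Iic (cumHazard ν x)) :=
    measurable_cumHazard measurableSet_Iic
  refine ae_eq_of_subset_of_measure_ge
    (fun y hy => cumHazard_le_of_le hy hx) ?_ measurableSet_Iic.nullMeasurableSet
    (measure_ne_top _ _)
  rw [← compl_Ioi, ← compl_Ioi, preimage_compl, measure_compl measurableSet_Ioi (by simp),
    measure_compl (measurable_cumHazard measurableSet_Ioi) (by simp),
    ← Measure.map_apply measurable_cumHazard measurableSet_Ioi, map_cumHazard,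
    measure_congr (Ioi_ae_eq_Ici (μ := eta)), eta_Ici (cumHazard_nonneg x), exp_neg_cumHazard hx,
    ofReal_survival]

/-- The hazard rate integrates to the cumulative hazard. -/
lemma setLIntegral_inv_survival {x : ℝ} (hx : 0 < survival ν x) :
    ∫⁻ y in Iic x, ENNReal.ofReal (survival ν y)⁻¹ ∂ν = ENNReal.ofReal (cumHazard ν x) := by
  -- Since `1 / G = exp S` and `S` pushes `ν` to `eta`, the integral becomes that of `exp s * exp
  -- (-s) = 1` over `[0, S x]`; no differentiation is needed.
  have h1 : ∫⁻ y in Iic x, ENNReal.ofReal (survival ν y)⁻¹ ∂ν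
      = ∫⁻ y in Iic x, ENNReal.ofReal (Real.exp (cumHazard ν y)) ∂ν := by
    refine lintegral_congr_ae (ae_restrict_of_ae ?_)
    filter_upwards [ae_survival_pos (ν := ν)] with y hy
    rw [← exp_neg_cumHazard hy, Real.exp_neg, inv_inv]
  rw [h1, setLIntegral_congr (Iic_ae_eq_cumHazard_le hx),
    ← setLIntegral_map (f := fun t => ENNReal.ofReal (Real.exp t)) measurableSet_Iic (by fun_prop)
      measurable_cumHazard, map_cumHazard, eta_eq_withDensity,
    setLIntegral_withDensity_eq_setLIntegral_mul _ (by fun_prop) (by fun_prop) measurableSet_Iic]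
  have h2 : ∀ s : ℝ, ((fun s => ENNReal.ofReal (Real.exp (-s))) *
      fun s => ENNReal.ofReal (Real.exp s)) s = 1 := fun s => by
    rw [Pi.mul_apply, ← ENNReal.ofReal_mul (by positivity), ← Real.exp_add]
    simp
  simp only [h2, lintegral_one, Measure.restrict_apply_univ]
  rw [Measure.restrict_apply measurableSet_Iic, inter_comm, Ici_inter_Iic, Real.volume_Icc, sub_zero]

end Survival

/-! ### The one-dimensional inequality. -/

lemma expCost₁_of_pos {x y : ℝ} (hx : 0 < x) (hy : 0 < y) :
    expCost₁ x y = ENNReal.ofReal (x - y - y * Real.log (x / y)) := by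
  rw [expCost₁, if_pos hy, expRate, if_pos (div_pos hx hy), ← ENNReal.ofReal_mul hy.le]
  congr 1
  field_simp

/-- The perspective form of the cost, in which Jensen applies to `klFun`. -/
lemma expCost₁_eq_klFun {x y : ℝ} (hx : 0 < x) (hy : 0 < y) :
    expCost₁ x y = ENNReal.ofReal (x * klFun (y / x)) := by
  rw [expCost₁_of_pos hx hy, klFun_apply, Real.log_div hx.ne' hy.ne', Real.log_div hy.ne' hx.ne']
  congr 1
  field_simp
  ring

/-- Jensen's inequality for the hazard rate. -/
lemma expCost₁_le_setLIntegral_klFun {x S : ℝ} (hx : 0 < x) (hS : 0 < S) {h : ℝ → ℝ}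
    (hh : Measurable h) (h0 : ∀ s, 0 ≤ h s)
    (hint : ∫⁻ s in Iic x, ENNReal.ofReal (h s) ∂halfLine = ENNReal.ofReal S) :
    expCost₁ x S ≤ ∫⁻ s in Iic x, ENNReal.ofReal (klFun (h s)) ∂halfLine := by
  have hvol : halfLine (Iic x) = ENNReal.ofReal x := by
    rw [Measure.restrict_apply measurableSet_Iic, inter_comm, Ici_inter_Iic, Real.volume_Icc,
      sub_zero]
  by_cases hfin : ∫⁻ s in Iic x, ENNReal.ofReal (klFun (h s)) ∂halfLine = ∞
  · rw [hfin]
    exact le_top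
  have hk : Measurable fun s => klFun (h s) := measurable_klFun.comp hh
  have hk0 : ∀ s, 0 ≤ klFun (h s) := fun s => klFun_nonneg (h0 s)
  have hfi : IntegrableOn h (Iic x) halfLine := by
    rw [IntegrableOn, ← lintegral_ofReal_ne_top_iff_integrable hh.aestronglyMeasurable
      (ae_of_all _ h0), hint]
    exact ENNReal.ofReal_ne_top
  have hgi : IntegrableOn (klFun ∘ h) (Iic x) halfLine :=
    (lintegral_ofReal_ne_top_iff_integrable hk.aestronglyMeasurable (ae_of_all _ hk0)).1 hfin
  have hI : ∫ s in Iic x, h s ∂halfLine = S := by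
    rw [integral_eq_lintegral_of_nonneg_ae (ae_of_all _ h0) hh.aestronglyMeasurable, hint,
      ENNReal.toReal_ofReal hS.le]
  have hJ := convexOn_klFun.map_set_average_le continuous_klFun.continuousOn isClosed_Ici
    (by rw [hvol]; simpa using hx) (by rw [hvol]; exact ENNReal.ofReal_ne_top)
    (ae_of_all _ h0) hfi hgi
  rw [setAverage_eq, setAverage_eq, hI, measureReal_def, hvol, ENNReal.toReal_ofReal hx.le,
    smul_eq_mul, smul_eq_mul, inv_mul_eq_div, inv_mul_eq_div, le_div_iff₀' hx] at hJ
  rw [expCost₁_eq_klFun hx hS,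
    ← ofReal_integral_eq_lintegral_ofReal (f := fun s => klFun (h s)) hgi (ae_of_all _ hk0)]
  exact ENNReal.ofReal_le_ofReal hJ

lemma measurable_expCost₁ : Measurable fun z : ℝ × ℝ => expCost₁ z.1 z.2 := by
  have hr : Measurable expRate :=
    Measurable.ite measurableSet_Ioi (by fun_prop) measurable_const
  refine Measurable.ite (measurable_snd measurableSet_Ioi)
    (measurable_snd.ennreal_ofReal.mul (hr.comp (measurable_fst.div measurable_snd)))
    (Measurable.ite ?_ (by fun_prop) measurable_const)
  exact (measurable_snd (measurableSet_singleton 0)).inter (measurable_fst measurableSet_Ici)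

lemma lintegral_setLIntegral_Iic {ν m : Measure ℝ} [SFinite ν] [SFinite m]
    [NullSingletonClass ν] {F : ℝ → ℝ≥0∞} (hF : Measurable F) :
    ∫⁻ x, ∫⁻ s in Iic x, F s ∂m ∂ν = ∫⁻ s, F s * ν (Ioi s) ∂m := by
  have hm : Measurable (Function.uncurry fun x s : ℝ => (Iic x).indicator F s) := by
    have : (Function.uncurry fun x s : ℝ => (Iic x).indicator F s)
        = {z : ℝ × ℝ | z.2 ≤ z.1}.indicator fun z => F z.2 := by
      ext z
      simp [Function.uncurry, indicator]
    rw [this]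
    exact (hF.comp measurable_snd).indicator (measurableSet_le measurable_snd measurable_fst)
  simp only [← lintegral_indicator measurableSet_Iic]
  rw [lintegral_lintegral_swap hm.aemeasurable]
  refine lintegral_congr fun s => ?_
  rw [measure_congr (Ioi_ae_eq_Ici (μ := ν)), ← lintegral_indicator_const measurableSet_Ici]
  refine lintegral_congr fun x => ?_
  simp [indicator]

/-- A form of the Legendre inequality between `klFun` and the exponential. -/
lemma mul_le_klFun_add_exp {u : ℝ} (hu : 0 ≤ u) (t : ℝ) :
    u * t ≤ klFun u + Real.exp t := by
  rcases hu.eq_or_lt with rfl | hu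
  · rw [klFun_zero]
    have := Real.exp_pos t
    linarith
  · have h := Real.add_one_le_exp (t - Real.log u)
    have h2 : Real.exp t = u * Real.exp (t - Real.log u) := by
      rw [Real.exp_sub, Real.exp_log hu]
      field_simp
    rw [h2, klFun_apply]
    nlinarith

/-- Here `f` is the density with respect to `eta` and `G` the survival function. Terms are placed so
that in the application all are nonnegative, allowing integration in `ℝ≥0∞` without subtraction. -/
lemma klFun_identity {f G s : ℝ} (hf : 0 ≤ f) (hG : 0 ≤ G) (h0 : G = 0 → f = 0) :
    klFun f * Real.exp (-s) + f * Real.exp (-s) * -Real.log G + G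
      = klFun (f * Real.exp (-s) / G) * G + f * Real.exp (-s) * s + Real.exp (-s) := by
  rcases hG.eq_or_lt with rfl | hG
  · simp [h0 rfl, klFun_zero]
  rcases hf.eq_or_lt with rfl | hf
  · simp [klFun_zero, add_comm]
  have he := Real.exp_pos (-s)
  rw [klFun_apply, klFun_apply, Real.log_div (by positivity) hG.ne',
    Real.log_mul hf.ne' he.ne', Real.log_exp]
  field_simp
  ring

theorem lintegral_expCost₁_cumHazard_le {ν : Measure ℝ} [IsProbabilityMeasure ν] (hν : ν ≪ eta) :
    ∫⁻ x, expCost₁ x (cumHazard ν x) ∂ν ≤ klDiv ν eta := by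
  have : NullSingletonClass ν := ⟨fun x => hν (measure_singleton x)⟩
  by_cases htop : klDiv ν eta = ∞
  · rw [htop]
    exact le_top
  set f : ℝ → ℝ := fun s => (ν.rnDeriv eta s).toReal with hf
  have hfm : Measurable f := (Measure.measurable_rnDeriv _ _).ennreal_toReal
  have hf0 : ∀ s, 0 ≤ f s := fun s => ENNReal.toReal_nonneg
  set p : ℝ → ℝ := fun s => f s * Real.exp (-s) with hp
  have hpm : Measurable p := by fun_prop
  have hp0 : ∀ s, 0 ≤ p s := fun s => mul_nonneg (hf0 s) (Real.exp_pos _).le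
  have hνf : ν = eta.withDensity fun s => ENNReal.ofReal (f s) := by
    conv_lhs => rw [← Measure.withDensity_rnDeriv_eq ν eta hν]
    refine withDensity_congr_ae ?_
    filter_upwards [ν.rnDeriv_ne_top eta] with s hs
    rw [hf, ENNReal.ofReal_toReal hs]
  have hνp : ν = halfLine.withDensity fun s => ENNReal.ofReal (p s) := by
    conv_lhs => rw [hνf, eta_eq_withDensity,
      ← withDensity_mul _ (by fun_prop) (by fun_prop)]
    congr 1
    ext s
    rw [Pi.mul_apply, mul_comm, ← ENNReal.ofReal_mul (hf0 s)]
  have hlint : ∀ g : ℝ → ℝ≥0∞, Measurable g →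
      ∫⁻ s, g s ∂ν = ∫⁻ s, ENNReal.ofReal (p s) * g s ∂halfLine := fun g hg => by
    conv_lhs => rw [hνp, lintegral_withDensity_eq_lintegral_mul _ (by fun_prop) hg]
    rfl
  have hset : ∀ {x : ℝ} (g : ℝ → ℝ≥0∞), Measurable g →
      ∫⁻ s in Iic x, g s ∂ν = ∫⁻ s in Iic x, ENNReal.ofReal (p s) * g s ∂halfLine :=
    fun g hg => by
      conv_lhs => rw [hνp, setLIntegral_withDensity_eq_setLIntegral_mul _ (by fun_prop) hg
        measurableSet_Iic]
      rfl
  have hlint_eta : ∀ g : ℝ → ℝ≥0∞, Measurable g →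
      ∫⁻ s, g s ∂eta = ∫⁻ s, ENNReal.ofReal (Real.exp (-s)) * g s ∂halfLine := fun g hg => by
    rw [eta_eq_withDensity, lintegral_withDensity_eq_lintegral_mul _ (by fun_prop) hg]
    rfl
  set G := survival ν with hG
  have hGm : Measurable G := measurable_survival
  have hG0 : ∀ s, 0 ≤ G s := fun s => survival_nonneg s
  -- Covers the points where `h = p / G` is a division by zero.
  have hpG : ∀ᵐ s ∂halfLine, G s = 0 → f s = 0 := by
    have h := ae_survival_pos (ν := ν)
    rw [hνp, ae_withDensity_iff (by fun_prop), ← hνp] at h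
    filter_upwards [h] with s hs hGs
    by_contra hne
    refine absurd (hs ?_) (by rw [← hG, hGs]; exact lt_irrefl 0)
    have : 0 < f s := lt_of_le_of_ne (hf0 s) (Ne.symm hne)
    simp only [ne_eq, ENNReal.ofReal_eq_zero, not_le, hp]
    positivity
  have hνpos : ∀ᵐ x ∂ν, 0 < x := hν.ae_le ae_eta_pos
  set h : ℝ → ℝ := fun s => p s / G s with hh
  have hhm : Measurable h := by fun_prop
  have hh0 : ∀ s, 0 ≤ h s := fun s => div_nonneg (hp0 s) (hG0 s)
  have hk : Measurable fun s => klFun (h s) := measurable_klFun.comp hhm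
  set C := ∫⁻ s, ENNReal.ofReal (klFun (h s) * G s) ∂halfLine with hC
  have step1 : ∫⁻ x, expCost₁ x (cumHazard ν x) ∂ν ≤ C := by
    calc ∫⁻ x, expCost₁ x (cumHazard ν x) ∂ν
        ≤ ∫⁻ x, ∫⁻ s in Iic x, ENNReal.ofReal (klFun (h s)) ∂halfLine ∂ν := by
          refine lintegral_mono_ae ?_
          filter_upwards [hνpos, ae_cumHazard_pos (ν := ν), ae_survival_pos (ν := ν)]
            with x hx hS hGx
          refine expCost₁_le_setLIntegral_klFun hx hS hhm hh0 ?_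
          rw [← setLIntegral_inv_survival hGx]
          rw [hset (fun s => ENNReal.ofReal (G s)⁻¹) (by fun_prop)]
          refine lintegral_congr fun s => ?_
          rw [← ENNReal.ofReal_mul (hp0 s), ← div_eq_mul_inv]
      _ = C := by
          rw [lintegral_setLIntegral_Iic (by fun_prop), hC]
          refine lintegral_congr fun s => ?_
          rw [← ofReal_survival, ENNReal.ofReal_mul (klFun_nonneg (hh0 s))]
  refine step1.trans ?_
  have hKL : klDiv ν eta = ∫⁻ s, ENNReal.ofReal (klFun (f s) * Real.exp (-s)) ∂halfLine := by
    rw [klDiv_eq_lintegral_klFun_of_ac hν, hlint_eta _ (by fun_prop)]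
    refine lintegral_congr fun s => ?_
    rw [mul_comm (klFun _), ENNReal.ofReal_mul (Real.exp_pos _).le]
  set M := ∫⁻ s, ENNReal.ofReal s ∂ν with hM
  have hMp : M = ∫⁻ s, ENNReal.ofReal (p s * s) ∂halfLine := by
    rw [hM, hlint _ (by fun_prop)]
    refine lintegral_congr fun s => ?_
    rw [ENNReal.ofReal_mul (hp0 s)]
  have hMG : M = ∫⁻ s, ENNReal.ofReal (G s) ∂halfLine := by
    rw [hM, lintegral_eq_lintegral_meas_lt ν (hνpos.mono fun _ h => h.le) aemeasurable_id,
      restrict_Ioi_eq_restrict_Ici]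
    refine lintegral_congr fun s => ?_
    rw [hG, ofReal_survival]
    rfl
  have hS : ∫⁻ s, ENNReal.ofReal (p s * -Real.log (G s)) ∂halfLine = 1 := by
    rw [← lintegral_cumHazard (ν := ν), hlint _ measurable_cumHazard.ennreal_ofReal]
    refine lintegral_congr fun s => ?_
    rw [ENNReal.ofReal_mul (hp0 s), cumHazard]
  -- Finite entropy forces a finite mean: apply the Legendre inequality at `t = s / 2`, since `exp
  -- (s / 2)` is `eta`-integrable.
  have hMtop : M ≠ ∞ := by
    have hb : ∀ s, ENNReal.ofReal (p s * s) ≤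
        2 * (ENNReal.ofReal (klFun (f s) * Real.exp (-s))
          + ENNReal.ofReal (Real.exp (-(1 / 2 * s)))) := fun s => by
      have h1 := mul_le_klFun_add_exp (hf0 s) (1 / 2 * s)
      have h2 : Real.exp (-(1 / 2 * s)) = Real.exp (1 / 2 * s) * Real.exp (-s) := by
        rw [← Real.exp_add]
        congr 1
        ring
      have h3 : 0 ≤ klFun (f s) * Real.exp (-s) :=
        mul_nonneg (klFun_nonneg (hf0 s)) (Real.exp_pos _).le
      rw [← ENNReal.ofReal_add h3 (Real.exp_pos _).le, ← ENNReal.ofReal_ofNat,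
        ← ENNReal.ofReal_mul zero_le_two, h2]
      refine ENNReal.ofReal_le_ofReal ?_
      have := mul_le_mul_of_nonneg_right h1 (Real.exp_pos (-s)).le
      simp only [hp]
      linarith
    have he : ∫⁻ s, ENNReal.ofReal (Real.exp (-(1 / 2 * s))) ∂halfLine ≠ ∞ := by
      rw [lintegral_ofReal_ne_top_iff_integrable (by fun_prop)
        (ae_of_all _ fun _ => (Real.exp_pos _).le)]
      have := integrableOn_Ici_iff_integrableOn_Ioi (by simp) |>.2
        (exp_neg_integrableOn_Ioi 0 (b := 1 / 2) (by norm_num))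
      simpa only [IntegrableOn, neg_mul] using this
    rw [hMp]
    refine ne_top_of_le_ne_top ?_ (lintegral_mono hb)
    rw [lintegral_const_mul _ (by fun_prop), lintegral_add_left (by fun_prop), ← hKL]
    exact ENNReal.mul_ne_top (by simp) (ENNReal.add_ne_top.2 ⟨htop, he⟩)
  -- The integrated form of `klFun_identity`; the mean `M` is written through `G` on the left and
  -- through `p` on the right.
  have key : klDiv ν eta + 1 + M = C + M + 1 := by
    conv_lhs => rw [hMG]
    conv_rhs => rw [hMp]
    rw [hKL, ← hS, ← lintegral_add_left (by fun_prop), ← lintegral_add_left (by fun_prop),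
      hC, ← lintegral_add_left (by fun_prop), hS, ← lintegral_exp_neg_halfLine,
      ← lintegral_add_left (by fun_prop)]
    refine lintegral_congr_ae ?_
    filter_upwards [hpG, ae_restrict_mem measurableSet_Ici] with s hs (hs0 : 0 ≤ s)
    have e := (Real.exp_pos (-s)).le
    have k1 := mul_nonneg (klFun_nonneg (hf0 s)) e
    have k2 := mul_nonneg (klFun_nonneg (hh0 s)) (hG0 s)
    have k3 : 0 ≤ p s * -Real.log (G s) := mul_nonneg (hp0 s) (cumHazard_nonneg s)
    have k4 := mul_nonneg (hp0 s) hs0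
    rw [← ENNReal.ofReal_add k1 k3, ← ENNReal.ofReal_add (add_nonneg k1 k3) (hG0 s),
      ← ENNReal.ofReal_add k2 k4, ← ENNReal.ofReal_add (add_nonneg k2 k4) e]
    congr 1
    exact klFun_identity (hf0 s) (hG0 s) hs
  have key' : C + (M + 1) = klDiv ν eta + (M + 1) := by
    rw [← add_assoc, ← key, add_assoc, add_comm 1 M]
  exact ((ENNReal.add_left_inj (ENNReal.add_ne_top.2 ⟨hMtop, ENNReal.one_ne_top⟩)).1 key').le

/-! ### Tensorization. -/

/-- The divergence of two composition-products with the same first marginal is the average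
divergence of the kernels. -/
lemma klDiv_compProd_right_eq_lintegral {α β : Type*} [MeasurableSpace α] [MeasurableSpace β]
    [MeasurableSpace.CountableOrCountablyGenerated α β] {μ : Measure α} [IsFiniteMeasure μ]
    {κ η : Kernel α β} [IsFiniteKernel κ] [IsFiniteKernel η] (hac : ∀ᵐ a ∂μ, κ a ≪ η a) :
    klDiv (μ ⊗ₘ κ) (μ ⊗ₘ η) = ∫⁻ a, klDiv (κ a) (η a) ∂μ := by
  have hd : μ ⊗ₘ κ = (μ ⊗ₘ η).withDensity fun z => κ.rnDeriv η z.1 z.2 := by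
    rw [← Measure.compProd_withDensity (Kernel.measurable_rnDeriv κ η)]
    refine Measure.compProd_congr ?_
    filter_upwards [hac] with a ha using (Kernel.withDensity_rnDeriv_eq ha).symm
  have hm : Measurable fun z : α × β => κ.rnDeriv η z.1 z.2 := Kernel.measurable_rnDeriv κ η
  rw [klDiv_eq_lintegral_klFun_of_ac (Measure.absolutelyContinuous_compProd_right_iff.2 hac)]
  have h1 : (μ ⊗ₘ κ).rnDeriv (μ ⊗ₘ η) =ᵐ[μ ⊗ₘ η] fun z => κ.rnDeriv η z.1 z.2 := by
    rw [hd]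
    exact Measure.rnDeriv_withDensity _ hm
  have h2 : ∀ᵐ z ∂(μ ⊗ₘ η), ENNReal.ofReal (klFun ((μ ⊗ₘ κ).rnDeriv (μ ⊗ₘ η) z).toReal)
      = ENNReal.ofReal (klFun (κ.rnDeriv η z.1 z.2).toReal) := by
    filter_upwards [h1] with z hz
    rw [hz]
  rw [lintegral_congr_ae h2, Measure.lintegral_compProd
    (f := fun z => ENNReal.ofReal (klFun (κ.rnDeriv η z.1 z.2).toReal))
    (measurable_klFun.comp hm.ennreal_toReal).ennreal_ofReal]
  refine lintegral_congr_ae ?_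
  filter_upwards [hac] with a ha
  rw [klDiv_eq_lintegral_klFun_of_ac ha]
  refine lintegral_congr_ae ?_
  filter_upwards [Kernel.rnDeriv_eq_rnDeriv_measure (κ := κ) (η := η) (a := a)] with x hx
  rw [hx]

/-- Every probability measure absolutely continuous with respect to `μ` is transported to `μ` by a
measurable map whose cost is at most the relative entropy. -/
def HasEntropicTransport {E : Type*} [MeasurableSpace E] (c : E → E → ℝ≥0∞) (μ : Measure E) :
    Prop :=
  ∀ ν : Measure E, IsProbabilityMeasure ν → ν ≪ μ →
    ∃ T : E → E, Measurable T ∧ ν.map T = μ ∧ ∫⁻ x, c x (T x) ∂ν ≤ klDiv ν μ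

/-- A triangular (Knothe) map: the first component is moved by the given transport of the first
marginal, the last by the cumulative hazard of its conditional law. -/
lemma HasEntropicTransport.prod_eta {E : Type*} [MeasurableSpace E] {c : E → E → ℝ≥0∞}
    {μ : Measure E} [IsProbabilityMeasure μ] (hc : Measurable fun z : E × E => c z.1 z.2)
    (h : HasEntropicTransport c μ) :
    HasEntropicTransport (fun x y : E × ℝ => c x.1 y.1 + expCost₁ x.2 y.2) (μ.prod eta) := by
  intro ρ hρ hac
  set ν := ρ.fst with hν
  set κ := ρ.condKernel with hκ
  have hdis : ν ⊗ₘ κ = ρ := ρ.disintegrate ρ.condKernel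
  have hprod : μ ⊗ₘ Kernel.const E eta = μ.prod eta := Measure.compProd_const
  have hac' : ν ⊗ₘ κ ≪ μ ⊗ₘ Kernel.const E eta := by rwa [hdis, hprod]
  have hνμ : ν ≪ μ := Measure.absolutelyContinuous_of_compProd hac'
  have hκη : ∀ᵐ e ∂ν, κ e ≪ eta := hac'.kernel_of_compProd
  obtain ⟨T, hT, hTmap, hTcost⟩ := h ν inferInstance hνμ
  set S : E × ℝ → ℝ := fun z => cumHazard (κ z.1) z.2 with hS
  -- Joint measurability: the survival of `κ e` at `x` is the kernel measure of a section of a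
  -- measurable set depending on `(e, x)`.
  have hSm : Measurable S := by
    have hset : MeasurableSet {w : (E × ℝ) × ℝ | w.1.2 < w.2} :=
      measurableSet_lt (by fun_prop) (by fun_prop)
    have := Kernel.measurable_kernel_prodMk_left (κ := κ.comap Prod.fst measurable_fst) hset
    exact (this.ennreal_toReal.log).neg
  refine ⟨fun z => (T z.1, S z), by fun_prop, ?_, ?_⟩
  -- Almost every conditional law is sent to the same `eta`, whatever the first component, so the
  -- image is a product.
  · rw [← hdis, eq_comm]
    refine Measure.prod_eq fun A B hA hB => ?_
    rw [Measure.map_apply (by fun_prop) (hA.prod hB),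
      Measure.compProd_apply ((by fun_prop : Measurable fun z : E × ℝ => (T z.1, S z))
        (hA.prod hB)), ← hTmap, Measure.map_apply hT hA, mul_comm,
      ← lintegral_indicator_const (hT hA)]
    refine lintegral_congr_ae ?_
    filter_upwards [hκη] with e he
    have : NullSingletonClass (κ e) := ⟨fun x => he (measure_singleton x)⟩
    by_cases heA : T e ∈ A
    · rw [indicator_of_mem (by exact heA)]
      have : Prod.mk e ⁻¹' ((fun z : E × ℝ => (T z.1, S z)) ⁻¹' A ×ˢ B)
          = cumHazard (κ e) ⁻¹' B := by
        ext x
        simp [heA, hS]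
      rw [this, ← Measure.map_apply measurable_cumHazard hB, map_cumHazard]
    · rw [indicator_of_notMem (by exact heA)]
      have : Prod.mk e ⁻¹' ((fun z : E × ℝ => (T z.1, S z)) ⁻¹' A ×ˢ B) = ∅ := by
        ext x
        simp [heA]
      rw [this, measure_empty]
  · have hm1 : Measurable fun z : E × ℝ => c z.1 (T z.1) :=
      hc.comp (measurable_fst.prodMk (hT.comp measurable_fst))
    have hm2 : Measurable fun z : E × ℝ => expCost₁ z.2 (S z) :=
      measurable_expCost₁.comp (measurable_snd.prodMk hSm)
    rw [lintegral_add_left hm1, ← hprod]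
    conv_lhs => rw [← hdis]
    conv_rhs => rw [← hdis]
    rw [klDiv_compProd_eq_add, klDiv_compProd_right_eq_lintegral hκη,
      Measure.lintegral_compProd hm1, Measure.lintegral_compProd hm2]
    refine add_le_add ?_ (lintegral_mono_ae ?_)
    · simpa using hTcost
    · filter_upwards [hκη] with e he
      exact lintegral_expCost₁_cumHazard_le he

/-- Conjugation by `φ`; pushing forward by `φ` does not increase the divergence. -/
lemma HasEntropicTransport.of_measurableEquiv {E F : Type*} [MeasurableSpace E]
    [MeasurableSpace F] {c : E → E → ℝ≥0∞} {d : F → F → ℝ≥0∞} {μ : Measure E} {ρ : Measure F}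
    [IsFiniteMeasure μ] [IsFiniteMeasure ρ]
    (φ : E ≃ᵐ F) (hφ : MeasurePreserving φ μ ρ)
    (hcd : ∀ x y, c x y = d (φ x) (φ y)) (h : HasEntropicTransport d ρ) :
    HasEntropicTransport c μ := by
  intro ν hν hac
  have : IsProbabilityMeasure (ν.map φ) := Measure.isProbabilityMeasure_map φ.measurable.aemeasurable
  obtain ⟨T, hT, hmap, hcost⟩ := h (ν.map φ) this (by
    rw [← hφ.map_eq]
    exact hac.map φ.measurable)
  refine ⟨φ.symm ∘ T ∘ φ, φ.symm.measurable.comp (hT.comp φ.measurable), ?_, ?_⟩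
  · rw [← Measure.map_map φ.symm.measurable (hT.comp φ.measurable),
      ← Measure.map_map hT φ.measurable, hmap, ← hφ.map_eq,
      Measure.map_map φ.symm.measurable φ.measurable]
    simp
  · rw [lintegral_map_equiv] at hcost
    refine le_trans (le_of_eq ?_) (hcost.trans ?_)
    · simp [hcd]
    · rw [← hφ.map_eq]
      exact klDiv_map_le ν μ φ.measurable

lemma measurable_expCost {n : ℕ} :
    Measurable fun z : (Fin n → ℝ) × (Fin n → ℝ) => expCost z.1 z.2 := by
  refine Finset.measurable_fun_sum _ fun i _ => ?_
  exact measurable_expCost₁.comp (f := fun z : (Fin n → ℝ) × (Fin n → ℝ) => (z.1 i, z.2 i))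
    (by fun_prop)

instance isProbabilityMeasure_etaPow (n : ℕ) : IsProbabilityMeasure (etaPow n) := by
  unfold etaPow
  infer_instance

lemma hasEntropicTransport_etaPow (n : ℕ) : HasEntropicTransport expCost (etaPow n) := by
  induction n with
  | zero =>
    intro ν hν _
    refine ⟨id, measurable_id, ?_, by simp [expCost]⟩
    rw [Measure.map_id]
    ext s hs
    rcases s.eq_empty_or_nonempty with rfl | hne
    · simp
    · rw [Subsingleton.eq_univ_of_nonempty hne, measure_univ, measure_univ]
  | succ n ih =>
    refine HasEntropicTransport.of_measurableEquiv
      ((MeasurableEquiv.piFinSuccAbove (fun _ : Fin (n + 1) => ℝ) 0).trans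
        MeasurableEquiv.prodComm) ?_ (fun x y => ?_) (ih.prod_eta measurable_expCost)
    · exact Measure.measurePreserving_swap.comp
        (measurePreserving_piFinSuccAbove (fun _ : Fin (n + 1) => eta) 0)
    · rw [expCost, Fin.sum_univ_succ, add_comm]
      rfl

theorem transportCost_expCost_le_klDiv {n : ℕ} (ν : Measure (Fin n → ℝ))
    [IsProbabilityMeasure ν] : transportCost expCost ν (etaPow n) ≤ klDiv ν (etaPow n) := by
  by_cases hac : ν ≪ etaPow n
  swap
  · rw [klDiv_of_not_ac hac]
    exact le_top
  obtain ⟨T, hT, hmap, hcost⟩ := hasEntropicTransport_etaPow n ν inferInstance hac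
  have hm : Measurable fun x => (x, T x) := measurable_id.prodMk hT
  refine (iInf₂_le (ν.map fun x => (x, T x)) ⟨?_, ?_⟩).trans (le_trans (le_of_eq ?_) hcost)
  · exact lintegral_map measurable_expCost hm
  · rw [Measure.map_map measurable_fst hm]
    exact Measure.map_id
  · rwa [Measure.map_map measurable_snd hm]

/-! ### Product densities and the classification of tilts. -/

section Pi

variable {ι : Type*} [Fintype ι] {E : ι → Type*} [∀ i, MeasurableSpace (E i)]
  {μ : ∀ i, Measure (E i)} [∀ i, IsProbabilityMeasure (μ i)] {f : ∀ i, E i → ℝ≥0∞}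

lemma lintegral_pi_prod (hf : ∀ i, Measurable (f i)) :
    ∫⁻ x, ∏ i, f i (x i) ∂Measure.pi μ = ∏ i, ∫⁻ t, f i t ∂μ i := by
  rw [lintegral_prod_eq_prod_lintegral_of_indepFun Finset.univ
    (fun i (x : ∀ i, E i) => f i (x i))
    (iIndepFun_pi fun i => (hf i).aemeasurable)
    fun i => (hf i).comp (measurable_pi_apply i)]
  refine Finset.prod_congr rfl fun i _ => ?_
  exact (measurePreserving_eval μ i).lintegral_comp (hf i)

lemma pi_withDensity [∀ i, SigmaFinite ((μ i).withDensity (f i))] (hf : ∀ i, Measurable (f i)) :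
    Measure.pi (fun i => (μ i).withDensity (f i))
      = (Measure.pi μ).withDensity fun x => ∏ i, f i (x i) := by
  refine Measure.pi_eq fun s hs => ?_
  rw [withDensity_apply _ (MeasurableSet.univ_pi hs),
    ← lintegral_indicator (MeasurableSet.univ_pi hs)]
  have : ∀ x : ∀ i, E i, (univ.pi s).indicator (fun x => ∏ i, f i (x i)) x
      = ∏ i, (s i).indicator (f i) (x i) := fun x => by
    by_cases hx : x ∈ univ.pi s
    · rw [indicator_of_mem hx]
      exact Finset.prod_congr rfl fun i _ => (indicator_of_mem (hx i (mem_univ i)) _).symm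
    · rw [indicator_of_notMem hx]
      obtain ⟨i, hi⟩ : ∃ i, x i ∉ s i := by simpa [Set.mem_pi] using hx
      exact (Finset.prod_eq_zero (Finset.mem_univ i) (indicator_of_notMem hi _)).symm
  simp only [this]
  rw [lintegral_pi_prod fun i => (hf i).indicator (hs i)]
  refine Finset.prod_congr rfl fun i _ => ?_
  rw [lintegral_indicator (hs i), withDensity_apply _ (hs i)]

end Pi

variable {n : ℕ}

/-- The logarithm of the density of a product of exponential measures of rates `b i`. -/
def logDensity (b x : Fin n → ℝ) : ℝ := ∑ i, ((1 - b i) * x i + Real.log (b i))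

lemma measurable_logDensity (b : Fin n → ℝ) : Measurable (logDensity b) := by
  unfold logDensity
  fun_prop

lemma pi_expMeasure_eq {b : Fin n → ℝ} (hb : ∀ i, 0 < b i) :
    Measure.pi (fun i => expMeasure (b i))
      = (etaPow n).withDensity fun x => ENNReal.ofReal (Real.exp (logDensity b x)) := by
  have h : (fun i => expMeasure (b i)) = fun i =>
      eta.withDensity fun x => ENNReal.ofReal (Real.exp ((1 - b i) * x + Real.log (b i))) :=
    funext fun i => expMeasure_eq_eta_withDensity (hb i)
  have : ∀ i, SigmaFinite
      (eta.withDensity fun x => ENNReal.ofReal (Real.exp ((1 - b i) * x + Real.log (b i)))) :=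
    fun i => by
      have := isProbabilityMeasure_expMeasure (hb i)
      rw [← expMeasure_eq_eta_withDensity (hb i)]
      infer_instance
  rw [h, pi_withDensity fun i => by fun_prop, etaPow]
  congr 1
  ext x
  rw [logDensity, Real.exp_sum, ENNReal.ofReal_prod_of_nonneg fun i _ => (Real.exp_pos _).le]

lemma isTilt_pi_expMeasure {b : Fin n → ℝ} (hb : ∀ i, 0 < b i) :
    IsTilt (Measure.pi fun i => expMeasure (b i)) (etaPow n) := by
  have := fun i => isProbabilityMeasure_expMeasure (hb i)
  refine ⟨inferInstance,
    (∑ i, (1 - b i) • (LinearMap.proj i : (Fin n → ℝ) →ₗ[ℝ] ℝ)).toAffineMap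
      + AffineMap.const ℝ _ (∑ i, Real.log (b i)), ?_⟩
  rw [pi_expMeasure_eq hb]
  congr 1
  ext x
  simp [logDensity, Finset.sum_add_distrib]

lemma affineMap_pi_eq_sum (l : (Fin n → ℝ) →ᵃ[ℝ] ℝ) :
    ∃ (a : Fin n → ℝ) (c : ℝ), ∀ x, l x = ∑ i, a i * x i + c := by
  refine ⟨fun i => l.linear fun j => if i = j then 1 else 0, l 0, fun x => ?_⟩
  have h := congrFun l.decomp x
  rw [h, Pi.add_apply, LinearMap.pi_apply_eq_sum_univ l.linear x]
  simp [mul_comm]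

lemma IsTilt.exists_pi_expMeasure {ν : Measure (Fin n → ℝ)} (h : IsTilt ν (etaPow n)) :
    ∃ b : Fin n → ℝ, (∀ i, 0 < b i) ∧ ν = Measure.pi fun i => expMeasure (b i) := by
  obtain ⟨hν, l, hl⟩ := h
  obtain ⟨a, c, hac⟩ := affineMap_pi_eq_sum l
  have hexp : ∀ x, ENNReal.ofReal (Real.exp (l x))
      = ENNReal.ofReal (Real.exp c) * ∏ i, ENNReal.ofReal (Real.exp (a i * x i)) := fun x => by
    rw [hac, Real.exp_add, Real.exp_sum, mul_comm, ENNReal.ofReal_mul (Real.exp_pos _).le,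
      ENNReal.ofReal_prod_of_nonneg fun i _ => (Real.exp_pos _).le]
  have hone : ENNReal.ofReal (Real.exp c) *
      ∏ i, ∫⁻ t, ENNReal.ofReal (Real.exp (a i * t)) ∂eta = 1 := by
    rw [← lintegral_pi_prod (f := fun i t => ENNReal.ofReal (Real.exp (a i * t)))
      fun i => by fun_prop, ← lintegral_const_mul _ (by fun_prop), ← measure_univ (μ := ν), hl,
      withDensity_apply _ MeasurableSet.univ, setLIntegral_univ, etaPow]
    simp only [hexp]
  -- An infinite factor times nonzero ones would make the total mass infinite.
  have ha : ∀ i, a i < 1 := by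
    intro i
    by_contra! hi
    have hne : ∀ j, ∫⁻ t, ENNReal.ofReal (Real.exp (a j * t)) ∂eta ≠ 0 := fun j => by
      refine ((lintegral_pos_iff_support (by fun_prop)).2 ?_).ne'
      have : (Function.support fun t => ENNReal.ofReal (Real.exp (a j * t))) = univ :=
        eq_univ_of_forall fun t => (ENNReal.ofReal_pos.2 (Real.exp_pos _)).ne'
      rw [this, measure_univ]
      exact one_pos
    rw [← Finset.mul_prod_erase _ _ (Finset.mem_univ i), lintegral_exp_mul_eta_eq_top hi,
      ENNReal.top_mul (Finset.prod_ne_zero_iff.2 fun j _ => hne j),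
      ENNReal.mul_top (by simpa using Real.exp_pos c)] at hone
    exact ENNReal.top_ne_one hone
  have hb : ∀ i, 0 < 1 - a i := fun i => sub_pos.2 (ha i)
  refine ⟨fun i => 1 - a i, hb, ?_⟩
  have := fun i => isProbabilityMeasure_expMeasure (hb i)
  set ρ := Measure.pi fun i => expMeasure (1 - a i) with hρ
  set C := ENNReal.ofReal (Real.exp (∑ i, Real.log (1 - a i) - c)) with hC
  -- Only the additive constant can differ, and equal total masses then force `C = 1`.
  have hρν : ρ = C • ν := by
    rw [hρ, pi_expMeasure_eq hb, hl, ← withDensity_smul _ ?_]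
    · congr 1
      ext x
      rw [Pi.smul_apply, smul_eq_mul, hC, ← ENNReal.ofReal_mul (Real.exp_pos _).le,
        ← Real.exp_add, hac, logDensity, Finset.sum_add_distrib]
      simp only [sub_sub_cancel]
      congr 2
      ring
    · simp only [hac]
      fun_prop
  have hC1 : C = 1 := by
    have := measure_univ (μ := ρ)
    rwa [hρν, Measure.smul_apply, measure_univ, smul_eq_mul, mul_one] at this
  rw [hρν, hC1, one_smul]

lemma isTilt_etaPow_iff (ν : Measure (Fin n → ℝ)) : IsTilt ν (etaPow n) ↔
    ∃ r : Fin n → ℝ, (∀ i, 0 < r i) ∧ ν = Measure.pi fun i => eta.map fun x => r i * x := by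
  constructor
  · intro h
    obtain ⟨b, hb, hν⟩ := h.exists_pi_expMeasure
    refine ⟨fun i => (b i)⁻¹, fun i => inv_pos.2 (hb i), ?_⟩
    simpa only [map_mul_left_eta (inv_pos.2 (hb _)), inv_inv] using hν
  · rintro ⟨r, hr, rfl⟩
    simp only [map_mul_left_eta (hr _)]
    exact isTilt_pi_expMeasure fun i => inv_pos.2 (hr i)

/-! ### Equality for tilts, by duality. -/

lemma klDiv_pi_expMeasure {b : Fin n → ℝ} (hb : ∀ i, 0 < b i) :
    klDiv (Measure.pi fun i => expMeasure (b i)) (etaPow n)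
      = ENNReal.ofReal (∫ x, logDensity b x ∂Measure.pi fun i => expMeasure (b i)) := by
  have := fun i => isProbabilityMeasure_expMeasure (hb i)
  set ν := Measure.pi fun i => expMeasure (b i) with hν
  have hm := measurable_logDensity b
  have hac : ν ≪ etaPow n := by
    rw [hν, pi_expMeasure_eq hb]
    exact withDensity_absolutelyContinuous _ _
  have hllr : llr ν (etaPow n) =ᵐ[ν] logDensity b := by
    have h : ν.rnDeriv (etaPow n) =ᵐ[etaPow n]
        fun x => ENNReal.ofReal (Real.exp (logDensity b x)) := by
      rw [hν, pi_expMeasure_eq hb]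
      exact Measure.rnDeriv_withDensity _ (by fun_prop)
    filter_upwards [hac.ae_eq h] with x hx
    rw [llr, hx, ENNReal.toReal_ofReal (Real.exp_pos _).le, Real.log_exp]
  have hint : Integrable (logDensity b) ν := by
    refine integrable_finsetSum _ fun i _ => ((Integrable.const_mul ?_ _).add (integrable_const _))
    exact integrable_comp_eval (μ := fun i => expMeasure (b i)) (i := i)
      (integrable_id_expMeasure (hb i))
  rw [klDiv_of_ac_of_integrable hac (hint.congr hllr.symm), integral_congr_ae hllr]
  simp

/-- For positive `x`, `y` this is `log t ≤ t - 1` at `t = b * x / y`, with equality along `y = b *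
x`, the graph of the optimal map. -/
lemma ofReal_le_expCost₁ {b : ℝ} (hb : 0 < b) (x y : ℝ) :
    ENNReal.ofReal ((1 - b) * x + y * Real.log b) ≤ expCost₁ x y := by
  rcases lt_trichotomy y 0 with hy | rfl | hy
  · rw [expCost₁, if_neg hy.not_gt, if_neg fun h => hy.ne h.1]
    exact le_top
  · rw [expCost₁, if_neg (lt_irrefl 0)]
    split_ifs with h
    · refine ENNReal.ofReal_le_ofReal ?_
      nlinarith [h.2]
    · exact le_top
  · rcases le_or_gt x 0 with hx | hx
    · rw [expCost₁, if_pos hy, expRate, if_neg (not_lt.2 (div_nonpos_of_nonpos_of_nonneg hx hy.le)),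
        ENNReal.mul_top (by simpa using hy)]
      exact le_top
    · rw [expCost₁_of_pos hx hy]
      refine ENNReal.ofReal_le_ofReal ?_
      have h := Real.log_le_sub_one_of_pos (show 0 < b * (x / y) by positivity)
      rw [Real.log_mul hb.ne' (by positivity)] at h
      have h2 := mul_le_mul_of_nonneg_left h hy.le
      have h3 : y * (b * (x / y) - 1) = b * x - y := by field_simp
      linarith

lemma _root_.MeasureTheory.MeasurePreserving.integrable {α : Type*} [MeasurableSpace α]
    {π : Measure α} {ρ : Measure ℝ} {T : α → ℝ} (hT : MeasurePreserving T π ρ)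
    (h : Integrable (fun t => t) ρ) : Integrable T π :=
  hT.integrable_comp_of_integrable h

lemma _root_.MeasureTheory.MeasurePreserving.integral_eq {α : Type*} [MeasurableSpace α]
    {π : Measure α} {ρ : Measure ℝ} {T : α → ℝ} (hT : MeasurePreserving T π ρ) :
    ∫ z, T z ∂π = ∫ t, t ∂ρ := by
  rw [← hT.map_eq, integral_map hT.aemeasurable (by fun_prop)]

lemma ofReal_integral_le_lintegral {α : Type*} [MeasurableSpace α] {π : Measure α} {g : α → ℝ}
    (hg : Integrable g π) : ENNReal.ofReal (∫ z, g z ∂π) ≤ ∫⁻ z, ENNReal.ofReal (g z) ∂π := by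
  calc ENNReal.ofReal (∫ z, g z ∂π) ≤ ENNReal.ofReal (∫ z, max (g z) 0 ∂π) :=
        ENNReal.ofReal_le_ofReal (integral_mono hg hg.pos_part fun z => le_max_left _ _)
    _ = ∫⁻ z, ENNReal.ofReal (g z) ∂π := by
        rw [ofReal_integral_eq_lintegral_ofReal hg.pos_part (ae_of_all _ fun z => le_max_right _ _)]
        simp

theorem transportCost_eq_klDiv_of_isTilt {ν : Measure (Fin n → ℝ)} (h : IsTilt ν (etaPow n)) :
    transportCost expCost ν (etaPow n) = klDiv ν (etaPow n) := by
  obtain ⟨b, hb, rfl⟩ := h.exists_pi_expMeasure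
  have := fun i => isProbabilityMeasure_expMeasure (hb i)
  refine le_antisymm (transportCost_expCost_le_klDiv _) (le_iInf₂ fun π hπ => ?_)
  set ν := Measure.pi fun i => expMeasure (b i) with hν
  have hfst : ∀ i, MeasurePreserving (fun z : (Fin n → ℝ) × (Fin n → ℝ) => z.1 i) π
      (expMeasure (b i)) := fun i =>
    (measurePreserving_eval (fun i => expMeasure (b i)) i).comp ⟨measurable_fst, hπ.1⟩
  have hsnd : ∀ i, MeasurePreserving (fun z : (Fin n → ℝ) × (Fin n → ℝ) => z.2 i) π eta :=
    fun i => (measurePreserving_eval (fun _ => eta) i).comp ⟨measurable_snd, hπ.2⟩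
  have heval : ∀ i, MeasurePreserving (fun x : Fin n → ℝ => x i) ν (expMeasure (b i)) :=
    measurePreserving_eval _
  have hIx := fun i => (hfst i).integrable (integrable_id_expMeasure (hb i))
  have hIy := fun i => (hsnd i).integrable integrable_id_eta
  have hIx' := fun i => (heval i).integrable (integrable_id_expMeasure (hb i))
  have : IsProbabilityMeasure π := by
    refine ⟨?_⟩
    rw [← measure_univ (μ := ν), ← hπ.1, Measure.map_apply measurable_fst MeasurableSet.univ,
      preimage_univ]
  set g : (Fin n → ℝ) × (Fin n → ℝ) → ℝ := fun z =>
    ∑ i, ((1 - b i) * z.1 i + z.2 i * Real.log (b i)) with hg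
  have hgi : ∀ i, Integrable (fun z : (Fin n → ℝ) × (Fin n → ℝ) =>
      (1 - b i) * z.1 i + z.2 i * Real.log (b i)) π := fun i =>
    ((hIx i).const_mul _).add ((hIy i).mul_const _)
  have hli : ∀ i, Integrable (fun x : Fin n → ℝ => (1 - b i) * x i + Real.log (b i)) ν :=
    fun i => ((hIx' i).const_mul _).add (integrable_const _)
  -- The mean of `eta` being `1` turns `z.2 i * log (b i)` into the constant `log (b i)`.
  have hgint : ∫ z, g z ∂π = ∫ x, logDensity b x ∂ν := by
    simp only [hg, logDensity]
    rw [integral_finsetSum _ fun i _ => hgi i, integral_finsetSum _ fun i _ => hli i]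
    refine Finset.sum_congr rfl fun i _ => ?_
    rw [integral_add ((hIx i).const_mul _) ((hIy i).mul_const _),
      integral_add ((hIx' i).const_mul _) (integrable_const _), integral_const_mul,
      integral_const_mul, integral_mul_const, (hfst i).integral_eq, (hsnd i).integral_eq,
      (heval i).integral_eq, integral_id_eta]
    simp
  rw [klDiv_pi_expMeasure hb, ← hν, ← hgint]
  calc ENNReal.ofReal (∫ z, g z ∂π) ≤ ∫⁻ z, ENNReal.ofReal (g z) ∂π :=
        ofReal_integral_le_lintegral (integrable_finsetSum _ fun i _ => hgi i)
    -- Individual summands of `g` may be negative, so only subadditivity of `ENNReal.ofReal` is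
    -- available.
    _ ≤ ∫⁻ z, expCost z.1 z.2 ∂π := lintegral_mono fun z =>
        (Finset.le_sum_of_subadditive _ ENNReal.ofReal_zero.le
          (fun _ _ => ENNReal.ofReal_add_le) _ _).trans
          (Finset.sum_le_sum fun i _ => ofReal_le_expCost₁ (hb i) _ _)

end TranspExp

end

theorem mainTheorem7 (n : ℕ) :
    (∀ ν : Measure (Fin n → ℝ), IsProbabilityMeasure ν →
      TranspExp.transportCost TranspExp.expCost ν (TranspExp.etaPow n)
        ≤ klDiv ν (TranspExp.etaPow n)) ∧
    (∀ ν : Measure (Fin n → ℝ), TranspExp.IsTilt ν (TranspExp.etaPow n) →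
      TranspExp.transportCost TranspExp.expCost ν (TranspExp.etaPow n)
        = klDiv ν (TranspExp.etaPow n)) ∧
    (∀ ν : Measure (Fin n → ℝ), TranspExp.IsTilt ν (TranspExp.etaPow n) ↔
      ∃ r : Fin n → ℝ, (∀ i, 0 < r i) ∧
        ν = Measure.pi fun i => TranspExp.eta.map fun x => r i * x) :=
  ⟨fun ν _ => TranspExp.transportCost_expCost_le_klDiv ν,
    fun _ h => TranspExp.transportCost_eq_klDiv_of_isTilt h, TranspExp.isTilt_etaPow_iff⟩
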